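/- Let $X$ be a real-valued random variable taking values (almost surely) in a set $\mathcal X\subseteq\mathbb R$, whose distribution has no singular continuous component, i.e., $P_X=P_X^{ac}+P_X^{d}$ with $P_X^{ac}$ absolutely continuous with respect to Lebesgue measure and $P_X^{d}$ concentrated on an at most countable set, and assume $0<P_X^{ac}(\mathcal X)\le 1$. Let $\mathcal X_1,\dots,\mathcal X_K$ be a finite partition of $\mathcal X$ into compact sets, let $g:\mathcal X\to\mathbb R$ be a bounded measurable function such that each restriction $g|_{\mathcal X_i}$ is injective or constant, and let $Y=g(X)$. For $n\in\mathbb N$ let $\hat X_n=\lfloor 2^nX\rfloor/2^n$, let $H(\hat X_n)$ be its entropy, and let $H(\hat X_n|Y)=\int H(\hat X_n|Y=y)\,dP_Y(y)$ be its conditional entropy given $Y$. Then $0<H(\hat X_n)<\infty$ for all sufficiently large $n$, and the relative information loss $l(X\to Y)=\lim_{n\to\infty}\frac{H(\hat X_n|Y)}{H(\hat X_n)}$ exists and equals \[ l(X\to Y)=\frac{P_X^{ac}(A)}{P_X^{ac}(\mathcal X)}, \] where $A$ is the union of those sets $\mathcal X_i$ on which $g$ is constant. -/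

import Mathlib

open MeasureTheory ProbabilityTheory Filter Topology
open scoped ENNReal

noncomputable section

namespace InfoLoss

/-- A measure is discrete if it is concentrated on a countable set. -/
def IsDiscrete {α : Type*} [MeasurableSpace α] (μ : Measure α) : Prop :=
  ∃ S : Set α, S.Countable ∧ μ Sᶜ = 0

open Classical in
/-- The entropy, in bits, of a probability law `μ`: it is `∑ x, μ {x} * log₂ (1 / μ {x})` (possibly
infinite) if `μ` is discrete, and infinite otherwise. -/
def entropy {α : Type*} [MeasurableSpace α] (μ : Measure α) : ℝ≥0∞ :=
  if IsDiscrete μ then ∑' x : α, ENNReal.ofReal (Real.negMulLog (μ.real {x}) / Real.log 2) else ⊤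

/-- The conditional entropy `H(Z | Y) = ∫ H(Z | Y = y) dP_Y(y)`, where `H(Z | Y = y)` is the entropy
of the regular conditional distribution of `Z` given `Y = y`. -/
def condEntropy {Ω : Type*} [MeasurableSpace Ω] (P : Measure Ω) [IsFiniteMeasure P]
    (Z Y : Ω → ℝ) : ℝ≥0∞ :=
  ∫⁻ y, entropy (condDistrib Z Y P y) ∂(P.map Y)

/-- The uniform quantizer with cells `[k / 2 ^ n, (k + 1) / 2 ^ n)`. -/
def quantize (n : ℕ) (x : ℝ) : ℝ := (⌊(2 : ℝ) ^ n * x⌋ : ℝ) / 2 ^ n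

/-- The relative information loss `l(X → Y)`, i.e. the limit of `H(X̂ₙ | Y) / H(X̂ₙ)` where `X̂ₙ` is
the quantization of `X`, exists and equals `l`. The quotients are required to be meaningful for
all large `n`. -/
def HasRelInfoLoss {Ω : Type*} [MeasurableSpace Ω] (P : Measure Ω) [IsFiniteMeasure P]
    (X Y : Ω → ℝ) (l : ℝ≥0∞) : Prop :=
  (∀ᶠ n : ℕ in atTop, 0 < entropy (P.map (fun ω => quantize n (X ω))) ∧
      entropy (P.map (fun ω => quantize n (X ω))) < ⊤) ∧
  Tendsto (fun n : ℕ => condEntropy P (fun ω => quantize n (X ω)) Y /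
      entropy (P.map (fun ω => quantize n (X ω)))) atTop (𝓝 l)

/-- `g` is constant on the set `s`. -/
def IsConstOn (g : ℝ → ℝ) (s : Set ℝ) : Prop := ∃ c : ℝ, ∀ x ∈ s, g x = c

end InfoLoss

end

/-!
Both entropies grow linearly in `n`, and the loss is the quotient of the two growth rates.

Rényi: passing from `quantize 0` to `quantize n` cuts a cell into `2 ^ n`, so a law of mass `m`
gains at most `m * n` bits. Up to arbitrarily small mass, the discrete part lives on finitely many
points and gains a bounded amount, while the density of the absolutely continuous part is bounded,
so that all its cells have mass `O(2⁻ⁿ)` and it gains `n` bits per unit of mass. Hence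
`H(X̂ₙ) / n` tends to `Pac 𝒳`.

The values of `g` on `A` form a finite set `C`. Given `Y = y` with `y ∈ C`, the law of `X` is that
of `X` restricted to `g ⁻¹' {y}`, and Rényi's theorem yields the growth rate `Pac (g ⁻¹' {y})`;
these add up to `Pac (g ⁻¹' C) = Pac A`. Off `C` the fibres of `g` have boundedly many points, so
the conditional entropy stays bounded there.
-/

namespace InfoLoss

section EntropyTerm

/-- The contribution `p * log₂ (1 / p)`, in bits, of an atom of mass `p` to the entropy. -/
noncomputable def entropyTerm (p : ℝ) : ℝ≥0∞ := ENNReal.ofReal (Real.negMulLog p / Real.log 2)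

lemma negMulLog_le_tangent {x y : ℝ} (hx : 0 ≤ x) (hy : 0 < y) :
    Real.negMulLog x ≤ y - x - x * Real.log y := by
  rcases hx.eq_or_lt with rfl | hx
  · simpa using hy.le
  have h : x * Real.log (y / x) ≤ x * (y / x - 1) :=
    mul_le_mul_of_nonneg_left (Real.log_le_sub_one_of_pos (div_pos hy hx)) hx.le
  rw [Real.log_div hy.ne' hx.ne', mul_sub_one, mul_div_cancel₀ y hx.ne'] at h
  rw [Real.negMulLog]
  linarith

lemma negMulLog_le_log_two {x : ℝ} (hx : 0 ≤ x) : Real.negMulLog x ≤ Real.log 2 := by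
  have h := negMulLog_le_tangent hx (y := 2⁻¹) (by norm_num)
  rw [Real.log_inv] at h
  nlinarith [Real.log_two_gt_d9, Real.log_two_lt_d9]

lemma negMulLog_add_le {x y : ℝ} (hx : 0 ≤ x) (hy : 0 ≤ y) :
    Real.negMulLog (x + y) ≤ Real.negMulLog x + Real.negMulLog y := by
  have mul_log_le {a b : ℝ} (ha : 0 ≤ a) (hb : 0 ≤ b) : a * Real.log a ≤ a * Real.log (a + b) := by
    rcases ha.eq_or_lt with rfl | ha
    · simp
    · gcongr
      linarith
  have hx' := mul_log_le hx hy
  have hy' := mul_log_le hy hx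
  rw [add_comm y x] at hy'
  simp only [Real.negMulLog]
  linarith

lemma negMulLog_le_add_mul_log_two {x y : ℝ} (hx : 0 ≤ x) (hxy : x ≤ y) (hy : y ≤ 1) :
    Real.negMulLog x ≤ Real.negMulLog y + y * Real.log 2 := by
  rcases (hx.trans hxy).eq_or_lt with rfl | hy₀
  · simp [le_antisymm hxy hx]
  have h := negMulLog_le_tangent hx (half_pos hy₀)
  have hlog : (y - x) * Real.log y ≤ 0 :=
    mul_nonpos_of_nonneg_of_nonpos (sub_nonneg.2 hxy) (Real.log_nonpos hy₀.le hy)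
  rw [Real.log_div hy₀.ne' two_ne_zero] at h
  rw [Real.negMulLog.eq_def y]
  nlinarith [Real.log_two_gt_d9, Real.log_two_lt_d9]

lemma sum_negMulLog_le {ι : Type*} {s : Finset ι} {p : ι → ℝ} (hp : ∀ i ∈ s, 0 ≤ p i) {N : ℕ}
    (hN : s.card ≤ N) :
    ∑ i ∈ s, Real.negMulLog (p i)
      ≤ Real.negMulLog (∑ i ∈ s, p i) + (∑ i ∈ s, p i) * Real.log N := by
  rcases (Finset.sum_nonneg hp).eq_or_lt with h₀ | hS
  · have hp₀ : ∀ i ∈ s, p i = 0 := (Finset.sum_eq_zero_iff_of_nonneg hp).1 h₀.symm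
    rw [← h₀, Finset.sum_eq_zero fun i hi => by rw [hp₀ i hi, Real.negMulLog_zero]]
    simp
  set S := ∑ i ∈ s, p i with hS_def
  have hN₀ : 0 < (N : ℝ) := by
    have : s.Nonempty := Finset.nonempty_of_sum_ne_zero hS.ne'
    exact_mod_cast this.card_pos.trans_le hN
  calc ∑ i ∈ s, Real.negMulLog (p i)
      ≤ ∑ i ∈ s, (S / N - p i - p i * Real.log (S / N)) :=
        Finset.sum_le_sum fun i hi => negMulLog_le_tangent (hp i hi) (div_pos hS hN₀)
    _ = s.card * (S / N) - S - S * Real.log (S / N) := by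
        rw [Finset.sum_sub_distrib, Finset.sum_sub_distrib, ← Finset.sum_mul, ← hS_def]
        simp
    _ ≤ N * (S / N) - S - S * Real.log (S / N) := by gcongr
    _ = Real.negMulLog S + S * Real.log N := by
        rw [mul_div_cancel₀ S hN₀.ne', Real.log_div hS.ne' hN₀.ne', Real.negMulLog]
        ring

@[simp]
lemma entropyTerm_zero : entropyTerm 0 = 0 := by simp [entropyTerm]

lemma entropyTerm_le_one {p : ℝ} (hp : 0 ≤ p) : entropyTerm p ≤ 1 :=
  ENNReal.ofReal_le_one.2 <|
    div_le_one_of_le₀ (negMulLog_le_log_two hp) (Real.log_nonneg one_le_two)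

lemma entropyTerm_add_le {p q : ℝ} (hp : 0 ≤ p) (hq : 0 ≤ q) :
    entropyTerm (p + q) ≤ entropyTerm p + entropyTerm q := by
  refine le_trans (ENNReal.ofReal_le_ofReal ?_) ENNReal.ofReal_add_le
  rw [← add_div]
  gcongr
  exact negMulLog_add_le hp hq

lemma entropyTerm_le_entropyTerm_add {p q : ℝ} (hp : 0 ≤ p) (hpq : p ≤ q) (hq : q ≤ 1) :
    entropyTerm p ≤ entropyTerm q + ENNReal.ofReal q := by
  refine le_trans (ENNReal.ofReal_le_ofReal ?_) ENNReal.ofReal_add_le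
  have hlog : 0 < Real.log 2 := Real.log_pos one_lt_two
  rw [div_add' _ _ _ hlog.ne']
  gcongr
  exact negMulLog_le_add_mul_log_two hp hpq hq

lemma entropyTerm_mul_le {c p : ℝ} (hc : 1 ≤ c) (hp : 0 ≤ p) :
    entropyTerm (c * p) ≤ ENNReal.ofReal c * entropyTerm p := by
  rw [entropyTerm, entropyTerm, ← ENNReal.ofReal_mul (by linarith), ← mul_div_assoc]
  gcongr
  have : p * Real.negMulLog c ≤ 0 := by
    rw [Real.negMulLog, neg_mul]
    exact mul_nonpos_of_nonneg_of_nonpos hp (neg_nonpos.2 (Real.mul_log_nonneg hc))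
  rw [Real.negMulLog_mul]
  linarith

lemma mul_le_entropyTerm {p b : ℝ} (hp : 0 ≤ p) (hpb : p ≤ 2 ^ (-b)) :
    ENNReal.ofReal p * ENNReal.ofReal b ≤ entropyTerm p := by
  rcases hp.eq_or_lt with rfl | hp₀
  · simp
  have hlog : Real.log p ≤ -b * Real.log 2 := by
    simpa only [Real.log_rpow two_pos] using Real.log_le_log hp₀ hpb
  rw [← ENNReal.ofReal_mul hp, entropyTerm]
  refine ENNReal.ofReal_le_ofReal ((le_div_iff₀ (Real.log_pos one_lt_two)).2 ?_)
  rw [Real.negMulLog]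
  nlinarith

lemma sum_entropyTerm_le {ι : Type*} {s : Finset ι} {p : ι → ℝ} (hp : ∀ i ∈ s, 0 ≤ p i)
    (hsum : ∑ i ∈ s, p i ≤ 1) {N : ℕ} (hN : s.card ≤ N) :
    ∑ i ∈ s, entropyTerm (p i) ≤ entropyTerm (∑ i ∈ s, p i) +
      ENNReal.ofReal (∑ i ∈ s, p i) * ENNReal.ofReal (Real.logb 2 N) := by
  have hterm : ∀ i ∈ s, 0 ≤ Real.negMulLog (p i) / Real.log 2 := fun i hi =>
    div_nonneg (Real.negMulLog_nonneg (hp i hi) ((Finset.single_le_sum hp hi).trans hsum))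
      (Real.log_nonneg one_le_two)
  simp only [entropyTerm]
  rw [← ENNReal.ofReal_sum_of_nonneg hterm, ← ENNReal.ofReal_mul (Finset.sum_nonneg hp)]
  refine le_trans (ENNReal.ofReal_le_ofReal ?_) ENNReal.ofReal_add_le
  rw [← Finset.sum_div, Real.logb, ← mul_div_assoc, ← add_div]
  gcongr
  exact sum_negMulLog_le hp hN

end EntropyTerm

section Entropy

variable {α β : Type*} [MeasurableSpace α] [MeasurableSpace β] {μ ν : Measure α}

lemma IsDiscrete.of_absolutelyContinuous (hν : IsDiscrete ν) (h : μ ≪ ν) : IsDiscrete μ :=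
  hν.imp fun _ hS => ⟨hS.1, h hS.2⟩

lemma IsDiscrete.add (hμ : IsDiscrete μ) (hν : IsDiscrete ν) : IsDiscrete (μ + ν) := by
  obtain ⟨S, hS, hμS⟩ := hμ
  obtain ⟨T, hT, hνT⟩ := hν
  refine ⟨S ∪ T, hS.union hT, ?_⟩
  rw [Measure.add_apply, measure_mono_null (Set.compl_subset_compl.2 Set.subset_union_left) hμS,
    measure_mono_null (Set.compl_subset_compl.2 Set.subset_union_right) hνT, add_zero]

lemma tsum_measure_singleton_le [MeasurableSingletonClass α] (μ : Measure α) :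
    ∑' x, μ {x} ≤ μ Set.univ :=
  (tsum_meas_le_meas_iUnion_of_disjoint μ (fun x => measurableSet_singleton x)
    fun _ _ hxy => Set.disjoint_singleton.2 hxy).trans (measure_mono (Set.subset_univ _))

lemma IsDiscrete.tsum_measure_singleton [MeasurableSingletonClass α] (hμ : IsDiscrete μ) :
    ∑' x, μ {x} = μ Set.univ := by
  refine (tsum_measure_singleton_le μ).antisymm ?_
  obtain ⟨S, hS, hμS⟩ := hμ
  calc μ Set.univ = μ (⋃ x ∈ S, {x}) := by
        rw [Set.biUnion_of_singleton, ← measure_add_measure_compl hS.measurableSet, hμS, add_zero]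
    _ ≤ ∑' x : S, μ {x.1} := measure_biUnion_le μ hS _
    _ ≤ ∑' x, μ {x} := ENNReal.tsum_comp_le_tsum_of_injective Subtype.val_injective _

lemma measureReal_le_one (hμ : μ Set.univ ≤ 1) (s : Set α) : μ.real s ≤ 1 :=
  ENNReal.toReal_le_of_le_ofReal zero_le_one <| by
    simpa using (measure_mono (Set.subset_univ s)).trans hμ

lemma entropy_eq_tsum (hμ : IsDiscrete μ) : entropy μ = ∑' x, entropyTerm (μ.real {x}) :=
  if_pos hμ

lemma entropy_eq_top (hμ : ¬ IsDiscrete μ) : entropy μ = ⊤ := if_neg hμ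

lemma entropy_add_le (μ ν : Measure α) [IsFiniteMeasure μ] [IsFiniteMeasure ν] :
    entropy (μ + ν) ≤ entropy μ + entropy ν := by
  by_cases hμ : IsDiscrete μ
  swap
  · simp [entropy_eq_top hμ]
  by_cases hν : IsDiscrete ν
  swap
  · simp [entropy_eq_top hν]
  rw [entropy_eq_tsum hμ, entropy_eq_tsum hν, entropy_eq_tsum (hμ.add hν), ← ENNReal.tsum_add]
  refine ENNReal.tsum_le_tsum fun x => ?_
  rw [measureReal_add_apply]
  exact entropyTerm_add_le measureReal_nonneg measureReal_nonneg

lemma entropy_le_entropy_add_one [MeasurableSingletonClass α] (hνμ : ν ≤ μ)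
    (hμ : μ Set.univ ≤ 1) : entropy ν ≤ entropy μ + 1 := by
  by_cases hμd : IsDiscrete μ
  swap
  · simp [entropy_eq_top hμd]
  have : IsFiniteMeasure μ := ⟨hμ.trans_lt ENNReal.one_lt_top⟩
  rw [entropy_eq_tsum hμd,
    entropy_eq_tsum (hμd.of_absolutelyContinuous (Measure.absolutelyContinuous_of_le hνμ))]
  calc ∑' x, entropyTerm (ν.real {x})
      ≤ ∑' x, (entropyTerm (μ.real {x}) + ENNReal.ofReal (μ.real {x})) :=
        ENNReal.tsum_le_tsum fun x => entropyTerm_le_entropyTerm_add measureReal_nonneg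
          (ENNReal.toReal_mono (measure_ne_top μ _) (hνμ _)) (measureReal_le_one hμ _)
    _ ≤ ∑' x, entropyTerm (μ.real {x}) + 1 := by
        rw [ENNReal.tsum_add, tsum_congr fun x => ofReal_measureReal (measure_ne_top μ {x})]
        gcongr
        exact (tsum_measure_singleton_le μ).trans hμ

lemma entropyTerm_measureReal_singleton_eq_zero {S : Set α} (hμ : μ Sᶜ = 0) {x : α}
    (hx : x ∉ S) : entropyTerm (μ.real {x}) = 0 := by
  have h : μ {x} = 0 := measure_mono_null (Set.singleton_subset_iff.2 hx) hμ
  rw [measureReal_def, h, ENNReal.toReal_zero, entropyTerm_zero]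

lemma entropy_le_of_encard_le {S : Set α} (hμ : μ Sᶜ = 0) {N : ℕ} (hS : S.encard ≤ N) :
    entropy μ ≤ N := by
  have hfin : S.Finite := Set.finite_of_encard_le_coe hS
  have hzero : ∀ x ∉ hfin.toFinset, entropyTerm (μ.real {x}) = 0 := fun x hx =>
    entropyTerm_measureReal_singleton_eq_zero hμ fun hxS => hx (hfin.mem_toFinset.2 hxS)
  rw [entropy_eq_tsum ⟨S, hfin.countable, hμ⟩, tsum_eq_sum hzero]
  refine (Finset.sum_le_card_nsmul _ _ 1 fun x _ => entropyTerm_le_one measureReal_nonneg).trans ?_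
  rw [hfin.encard_eq_coe_toFinset_card, Nat.cast_le] at hS
  simpa using hS

lemma entropy_map_le_of_encard_le [MeasurableSingletonClass β] {f : α → β} (hf : Measurable f)
    {S : Set α} (hμ : μ Sᶜ = 0) {N : ℕ} (hS : S.encard ≤ N) : entropy (μ.map f) ≤ N := by
  have hfS : (f '' S).encard ≤ N := (Set.encard_image_le f S).trans hS
  refine entropy_le_of_encard_le ?_ hfS
  rw [Measure.map_apply hf (Set.finite_of_encard_le_coe hfS).measurableSet.compl]
  exact measure_mono_null (fun x hx hxS => hx ⟨x, hxS, rfl⟩) hμ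

lemma entropy_smul_le {c : ℝ≥0∞} (hc : 1 ≤ c) (hc_top : c ≠ ⊤) (μ : Measure α) :
    entropy (c • μ) ≤ c * entropy μ := by
  by_cases hμ : IsDiscrete μ
  swap
  · simp [entropy_eq_top hμ, (zero_lt_one.trans_le hc).ne']
  rw [entropy_eq_tsum hμ, entropy_eq_tsum
    (hμ.of_absolutelyContinuous (Measure.AbsolutelyContinuous.rfl.smul_left c)),
    ← ENNReal.tsum_mul_left]
  refine ENNReal.tsum_le_tsum fun x => ?_
  have hc_real : 1 ≤ c.toReal := by simpa using ENNReal.toReal_mono hc_top hc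
  have h := entropyTerm_mul_le hc_real (measureReal_nonneg (μ := μ) (s := {x}))
  rwa [ENNReal.ofReal_toReal hc_top, ← measureReal_ennreal_smul_apply] at h

lemma measure_univ_mul_le_entropy [MeasurableSingletonClass α] [IsFiniteMeasure μ] {b : ℝ}
    (hμ : ∀ x, μ.real {x} ≤ 2 ^ (-b)) : μ Set.univ * ENNReal.ofReal b ≤ entropy μ := by
  by_cases hμd : IsDiscrete μ
  swap
  · simp [entropy_eq_top hμd]
  rw [entropy_eq_tsum hμd, ← hμd.tsum_measure_singleton, ← ENNReal.tsum_mul_right]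
  refine ENNReal.tsum_le_tsum fun x => ?_
  have h := mul_le_entropyTerm measureReal_nonneg (hμ x)
  rwa [ofReal_measureReal] at h

lemma tsum_entropyTerm_fiber_le [MeasurableSingletonClass α] [MeasurableSingletonClass β]
    {φ : α → β} (hφ : Measurable φ) {S : Set α} (hμS : μ Sᶜ = 0) (hμ : μ Set.univ ≤ 1) {N : ℕ}
    {y : β} (hN : (S ∩ φ ⁻¹' {y}).encard ≤ N) :
    ∑' x : φ ⁻¹' {y}, entropyTerm (μ.real {x.1})
      ≤ entropyTerm ((μ.map φ).real {y}) + (μ.map φ) {y} * ENNReal.ofReal (Real.logb 2 N) := by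
  have : IsFiniteMeasure μ := ⟨hμ.trans_lt ENNReal.one_lt_top⟩
  have hfin : (S ∩ φ ⁻¹' {y}).Finite := Set.finite_of_encard_le_coe hN
  rw [hfin.encard_eq_coe_toFinset_card, Nat.cast_le] at hN
  have hmass : ∑ x ∈ hfin.toFinset, μ.real {x} = (μ.map φ).real {y} := by
    rw [sum_measureReal_singleton, hfin.coe_toFinset,
      map_measureReal_apply hφ (measurableSet_singleton y)]
    exact measureReal_congr (inter_ae_eq_right_of_ae_eq_univ (ae_eq_univ.2 hμS))
  have hsum : ∑' x : φ ⁻¹' {y}, entropyTerm (μ.real {x.1})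
      = ∑ x ∈ hfin.toFinset, entropyTerm (μ.real {x}) := by
    rw [tsum_subtype (φ ⁻¹' {y}) fun x => entropyTerm (μ.real {x}),
      tsum_eq_sum (s := hfin.toFinset)]
    · exact Finset.sum_congr rfl fun x hx => Set.indicator_of_mem (hfin.mem_toFinset.1 hx).2 _
    · intro x hx
      rw [hfin.mem_toFinset, Set.mem_inter_iff, not_and'] at hx
      exact Set.indicator_apply_eq_zero.2 fun hxy =>
        entropyTerm_measureReal_singleton_eq_zero hμS (hx hxy)
  have h := sum_entropyTerm_le (fun x _ => measureReal_nonneg)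
    (hmass.trans_le (measureReal_le_one (by simpa [hφ] using hμ) _)) hN
  rwa [← hsum, hmass, ofReal_measureReal] at h

lemma entropy_le_entropy_map_add [MeasurableSingletonClass α] [MeasurableSingletonClass β]
    {φ : α → β} (hφ : Measurable φ) {S : Set α} (hS : S.Countable) (hμS : μ Sᶜ = 0)
    (hμ : μ Set.univ ≤ 1) {N : ℕ} (hN : ∀ y, (S ∩ φ ⁻¹' {y}).encard ≤ N) :
    entropy μ ≤ entropy (μ.map φ) + μ Set.univ * ENNReal.ofReal (Real.logb 2 N) := by
  by_cases hd : IsDiscrete (μ.map φ)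
  swap
  · simp [entropy_eq_top hd]
  rw [entropy_eq_tsum ⟨S, hS, hμS⟩, entropy_eq_tsum hd, ← ENNReal.tsum_fiberwise _ φ]
  refine (ENNReal.tsum_le_tsum fun y => tsum_entropyTerm_fiber_le hφ hμS hμ (hN y)).trans ?_
  rw [ENNReal.tsum_add, ENNReal.tsum_mul_right]
  gcongr
  exact (tsum_measure_singleton_le _).trans_eq (by simp [hφ])

end Entropy

section Quantize

lemma measurable_quantize (n : ℕ) : Measurable (quantize n) := by
  unfold quantize
  fun_prop

lemma countable_range_quantize (n : ℕ) : (Set.range (quantize n)).Countable :=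
  (Set.countable_range fun k : ℤ => (k : ℝ) / 2 ^ n).mono <| by
    rintro _ ⟨x, rfl⟩
    exact ⟨⌊(2 : ℝ) ^ n * x⌋, rfl⟩

lemma quantize_zero (x : ℝ) : quantize 0 x = ⌊x⌋ := by simp [quantize]

lemma quantize_le (n : ℕ) (x : ℝ) : quantize n x ≤ x := by
  rw [quantize, div_le_iff₀ (by positivity), mul_comm]
  exact Int.floor_le _

lemma lt_quantize_add (n : ℕ) (x : ℝ) : x < quantize n x + (2 ^ n)⁻¹ := by
  rw [quantize, ← one_div, ← add_div, lt_div_iff₀ (by positivity), mul_comm]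
  exact Int.lt_floor_add_one _

lemma volume_quantize_preimage_singleton_le (n : ℕ) (x : ℝ) :
    volume (quantize n ⁻¹' {x}) ≤ ENNReal.ofReal (2 ^ n)⁻¹ := by
  have hsub : quantize n ⁻¹' {x} ⊆ Set.Ico x (x + (2 ^ n)⁻¹) := by
    rintro y rfl
    exact ⟨quantize_le n y, lt_quantize_add n y⟩
  simpa using measure_mono (μ := volume) hsub

lemma quantize_zero_quantize (n : ℕ) (x : ℝ) : quantize 0 (quantize n x) = quantize 0 x := by
  have hfloor : ⌊quantize n x⌋ = ⌊x⌋ := by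
    refine Int.floor_eq_iff.2 ⟨?_, (quantize_le n x).trans_lt (Int.lt_floor_add_one x)⟩
    have h : ⌊x⌋ * 2 ^ n ≤ ⌊(2 : ℝ) ^ n * x⌋ := by
      rw [Int.le_floor, mul_comm]
      push_cast
      gcongr
      exact Int.floor_le x
    rw [quantize, le_div_iff₀ (by positivity)]
    exact_mod_cast h
  rw [quantize_zero, quantize_zero, hfloor]

lemma encard_range_quantize_inter_fiber_le (n : ℕ) (y : ℝ) :
    (Set.range (quantize n) ∩ quantize 0 ⁻¹' {y}).encard ≤ (2 ^ n : ℕ) := by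
  have hsub : Set.range (quantize n) ∩ quantize 0 ⁻¹' {y} ⊆
      (fun k : ℤ => (k : ℝ) / 2 ^ n) '' Finset.Ico (⌊y⌋ * 2 ^ n) ((⌊y⌋ + 1) * 2 ^ n) := by
    rintro _ ⟨⟨x, rfl⟩, rfl⟩
    rw [quantize_zero_quantize, quantize_zero, Int.floor_intCast]
    refine ⟨⌊(2 : ℝ) ^ n * x⌋, ?_, rfl⟩
    rw [Finset.coe_Ico, Set.mem_Ico, Int.le_floor, Int.floor_lt, mul_comm (⌊x⌋ : ℤ),
      mul_comm (⌊x⌋ + 1 : ℤ)]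
    push_cast
    exact ⟨by gcongr; exact Int.floor_le x, by gcongr; exact Int.lt_floor_add_one x⟩
  refine (Set.encard_le_encard hsub).trans ((Set.encard_image_le _ _).trans_eq ?_)
  have htoNat : ((2 : ℤ) ^ n).toNat = 2 ^ n := by exact_mod_cast Int.toNat_natCast (2 ^ n)
  rw [Set.encard_coe_eq_coe_finsetCard, Int.card_Ico, ← sub_mul, add_sub_cancel_left, one_mul,
    htoNat]

lemma entropy_map_quantize_le (n : ℕ) {μ : Measure ℝ} (hμ : μ Set.univ ≤ 1) :
    entropy (μ.map (quantize n)) ≤ entropy (μ.map (quantize 0)) + μ Set.univ * n := by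
  have hq := measurable_quantize n
  have hrange : μ.map (quantize n) (Set.range (quantize n))ᶜ = 0 := by
    rw [Measure.map_apply hq (countable_range_quantize n).measurableSet.compl]
    simp
  have h := entropy_le_entropy_map_add (measurable_quantize 0) (countable_range_quantize n) hrange
    (by simpa [hq] using hμ) (encard_range_quantize_inter_fiber_le n)
  have hlogb : Real.logb 2 (2 ^ n : ℕ) = n := by
    rw [Nat.cast_pow, Nat.cast_ofNat, Real.logb_pow, Real.logb_self_eq_one one_lt_two, mul_one]
  have hcomp : quantize 0 ∘ quantize n = quantize 0 := funext (quantize_zero_quantize n)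
  rw [Measure.map_map (measurable_quantize 0) hq, hcomp, hlogb, ENNReal.ofReal_natCast,
    Measure.map_apply hq MeasurableSet.univ, Set.preimage_univ] at h
  exact h

lemma measure_univ_mul_le_entropy_map_quantize (n k : ℕ) {μ : Measure ℝ} [IsFiniteMeasure μ]
    (hμ : μ ≤ (2 ^ k : ℝ≥0∞) • volume) :
    μ Set.univ * (n - k) ≤ entropy (μ.map (quantize n)) := by
  have hq := measurable_quantize n
  have hatom (x : ℝ) : (μ.map (quantize n)).real {x} ≤ 2 ^ (-((n : ℝ) - k)) := by
    rw [neg_sub, Real.rpow_sub two_pos, Real.rpow_natCast, Real.rpow_natCast, div_eq_mul_inv,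
      map_measureReal_apply hq (measurableSet_singleton x)]
    refine ENNReal.toReal_le_of_le_ofReal (by positivity) ((hμ _).trans ?_)
    rw [Measure.smul_apply, smul_eq_mul, ENNReal.ofReal_mul (by positivity),
      ENNReal.ofReal_pow zero_le_two, ENNReal.ofReal_ofNat]
    gcongr
    exact volume_quantize_preimage_singleton_le n x
  simpa [hq, ENNReal.ofReal_sub] using measure_univ_mul_le_entropy hatom

lemma entropy_map_quantize_zero_ne_top {μ : Measure ℝ} {s : Set ℝ} (hs : Bornology.IsBounded s)
    (hμ : μ sᶜ = 0) : entropy (μ.map (quantize 0)) ≠ ⊤ := by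
  obtain ⟨r, hr⟩ := hs.subset_closedBall 0
  rw [Real.closedBall_eq_Icc, zero_sub, zero_add] at hr
  have hsub : quantize 0 '' s ⊆ (↑) '' (Finset.Icc ⌊-r⌋ ⌊r⌋ : Set ℤ) := by
    rintro _ ⟨x, hx, rfl⟩
    rw [quantize_zero]
    exact ⟨⌊x⌋, by simpa using ⟨Int.floor_mono (hr hx).1, Int.floor_mono (hr hx).2⟩, rfl⟩
  have hfin : (quantize 0 '' s).Finite := ((Finset.finite_toSet _).image _).subset hsub
  have hnull : μ.map (quantize 0) (quantize 0 '' s)ᶜ = 0 := by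
    rw [Measure.map_apply (measurable_quantize 0) hfin.measurableSet.compl]
    exact measure_mono_null (fun x hx hxs => hx ⟨x, hxs, rfl⟩) hμ
  refine ne_top_of_le_ne_top (ENNReal.natCast_ne_top _)
    (entropy_le_of_encard_le hnull hfin.encard_eq_coe_toFinset_card.le)

end Quantize

section Renyi

lemma tendsto_div_natCast_of_forall_lt {f : ℕ → ℝ≥0∞} {m : ℝ≥0∞}
    (hlower : ∀ b < m, ∃ C ≠ ⊤, ∀ n : ℕ, b * n ≤ f n + C)
    (hupper : ∀ b > m, ∃ C ≠ ⊤, ∀ n : ℕ, f n ≤ b * n + C) :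
    Tendsto (fun n : ℕ => f n / n) atTop (𝓝 m) := by
  have hconst_div {C : ℝ≥0∞} (hC : C ≠ ⊤) : Tendsto (fun n : ℕ => C / n) atTop (𝓝 0) := by
    simpa only [ENNReal.div_top] using
      ENNReal.Tendsto.const_div ENNReal.tendsto_nat_nhds_top (Or.inr hC)
  have hmul_div (b : ℝ≥0∞) {n : ℕ} (hn : 0 < n) : b * n / n = b :=
    ENNReal.mul_div_cancel_right (by exact_mod_cast hn.ne') (ENNReal.natCast_ne_top n)
  refine tendsto_order.2 ⟨fun b hb => ?_, fun b hb => ?_⟩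
  · obtain ⟨c, hbc, hcm⟩ := exists_between hb
    obtain ⟨C, hC, hle⟩ := hlower c hcm
    have hlim : Tendsto (fun n : ℕ => c - C / n) atTop (𝓝 c) := by
      simpa only [tsub_zero] using
        ENNReal.Tendsto.sub tendsto_const_nhds (hconst_div hC) (Or.inl hcm.ne_top)
    filter_upwards [hlim.eventually (lt_mem_nhds hbc), eventually_gt_atTop 0] with n hlt hn
    refine hlt.trans_le (tsub_le_iff_right.2 ?_)
    rw [← ENNReal.add_div, ← hmul_div c hn]
    exact ENNReal.div_le_div_right (hle n) _
  · obtain ⟨c, hmc, hcb⟩ := exists_between hb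
    obtain ⟨C, hC, hle⟩ := hupper c hmc
    have hlim : Tendsto (fun n : ℕ => c + C / n) atTop (𝓝 c) := by
      simpa only [add_zero] using tendsto_const_nhds.add (hconst_div hC)
    filter_upwards [hlim.eventually (gt_mem_nhds hcb), eventually_gt_atTop 0] with n hlt hn
    refine lt_of_le_of_lt ?_ hlt
    rw [← hmul_div c hn, ← ENNReal.add_div]
    exact ENNReal.div_le_div_right (hle n) _

lemma exists_lt_measure_restrict_le_smul {α : Type*} [MeasurableSpace α] {μ ν : Measure α}
    [SigmaFinite μ] [μ.HaveLebesgueDecomposition ν] (hμν : μ ≪ ν) {b : ℝ≥0∞}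
    (hb : b < μ Set.univ) :
    ∃ E, b < μ E ∧ ∃ k : ℕ, μ.restrict E ≤ (2 ^ k : ℝ≥0∞) • ν := by
  set E : ℕ → Set α := fun k => {x | μ.rnDeriv ν x ≤ 2 ^ k}
  have hE (k : ℕ) : MeasurableSet (E k) :=
    measurableSet_le (Measure.measurable_rnDeriv μ ν) measurable_const
  have hmono : Monotone E := fun j k hjk x hx =>
    show μ.rnDeriv ν x ≤ 2 ^ k from hx.out.trans (pow_le_pow_right₀ one_le_two hjk)
  have hUnion : μ (⋃ k, E k) = μ Set.univ := by
    refine measure_congr (eventuallyEq_univ.2 ?_)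
    filter_upwards [hμν.ae_le (Measure.rnDeriv_lt_top μ ν)] with x hx
    obtain ⟨k, hk⟩ := ENNReal.exists_nat_gt hx.ne
    exact Set.mem_iUnion.2 ⟨k, hk.le.trans (by exact_mod_cast Nat.lt_two_pow_self.le)⟩
  have hlim := tendsto_measure_iUnion_atTop (μ := μ) hmono
  rw [hUnion] at hlim
  obtain ⟨k, hk⟩ := (hlim.eventually (lt_mem_nhds hb)).exists
  refine ⟨E k, hk, k, ?_⟩
  calc μ.restrict (E k)
      = (ν.restrict (E k)).withDensity (μ.rnDeriv ν) := by
        rw [← restrict_withDensity (hE k), Measure.withDensity_rnDeriv_eq μ ν hμν]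
    _ ≤ (ν.restrict (E k)).withDensity fun _ => 2 ^ k :=
        withDensity_mono (ae_restrict_of_forall_mem (hE k) fun _ hx => hx)
    _ ≤ (2 ^ k : ℝ≥0∞) • ν := by
        rw [withDensity_const]
        gcongr
        exact Measure.restrict_le_self

lemma IsDiscrete.exists_finset_measure_compl_lt {α : Type*} [MeasurableSpace α]
    [MeasurableSingletonClass α] {μ : Measure α} [IsFiniteMeasure μ] (hμ : IsDiscrete μ)
    {ε : ℝ≥0∞} (hε : 0 < ε) : ∃ F : Finset α, μ (F : Set α)ᶜ < ε := by
  have hlim : Tendsto (fun F : Finset α => μ F) atTop (𝓝 (μ Set.univ)) := by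
    have hsum := (ENNReal.summable (f := fun x => μ {x})).hasSum
    simpa only [HasSum, SummationFilter.unconditional_filter, sum_measure_singleton,
      hμ.tsum_measure_singleton] using hsum
  have hcompl := ENNReal.Tendsto.sub (tendsto_const_nhds (x := μ Set.univ)) hlim
    (Or.inl (measure_ne_top μ _))
  rw [tsub_self] at hcompl
  obtain ⟨F, hF⟩ := (hcompl.eventually (gt_mem_nhds hε)).exists
  exact ⟨F, (measure_compl F.measurableSet (measure_ne_top μ _)).trans_lt hF⟩

variable {μ ν : Measure ℝ}

lemma exists_mul_le_entropy_map_quantize_add (hμ : μ ≪ volume) (hmass : (μ + ν) Set.univ ≤ 1)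
    {b : ℝ≥0∞} (hb : b < μ Set.univ) :
    ∃ C ≠ ⊤, ∀ n : ℕ, b * n ≤ entropy ((μ + ν).map (quantize n)) + C := by
  have : IsFiniteMeasure μ :=
    ⟨((Measure.le_add_right le_rfl _).trans hmass).trans_lt ENNReal.one_lt_top⟩
  obtain ⟨E, hbE, k, hk⟩ := exists_lt_measure_restrict_le_smul hμ hb
  have hle : μ.restrict E ≤ μ + ν :=
    Measure.restrict_le_self.trans (Measure.le_add_right le_rfl)
  refine ⟨1 + b * k, by finiteness [hb.ne_top], fun n => ?_⟩
  have hq := measurable_quantize n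
  calc b * n ≤ b * (n - k + k) := by
        gcongr
        exact le_tsub_add
    _ ≤ (μ.restrict E) Set.univ * (n - k) + b * k := by
        rw [mul_add, Measure.restrict_apply_univ]
        gcongr
    _ ≤ entropy ((μ.restrict E).map (quantize n)) + b * k := by
        gcongr
        exact measure_univ_mul_le_entropy_map_quantize n k hk
    _ ≤ entropy ((μ + ν).map (quantize n)) + 1 + b * k := by
        gcongr
        exact entropy_le_entropy_add_one (Measure.map_mono hle hq) (by simpa [hq] using hmass)
    _ = _ := add_assoc _ _ _

lemma exists_entropy_map_quantize_le_mul_add (hν : IsDiscrete ν) (hmass : (μ + ν) Set.univ ≤ 1)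
    (hfin : entropy ((μ + ν).map (quantize 0)) ≠ ⊤) {b : ℝ≥0∞} (hb : μ Set.univ < b) :
    ∃ C ≠ ⊤, ∀ n : ℕ, entropy ((μ + ν).map (quantize n)) ≤ b * n + C := by
  have : IsFiniteMeasure (μ + ν) := ⟨hmass.trans_lt ENNReal.one_lt_top⟩
  have : IsFiniteMeasure μ := isFiniteMeasure_of_le (μ + ν) (Measure.le_add_right le_rfl)
  have : IsFiniteMeasure ν := isFiniteMeasure_of_le (μ + ν) (Measure.le_add_left le_rfl)
  obtain ⟨F, hF⟩ := hν.exists_finset_measure_compl_lt (tsub_pos_of_lt hb)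
  set ρ := μ + ν.restrict (F : Set ℝ)ᶜ with hρ_def
  have hsplit : μ + ν = ρ + ν.restrict F := by
    rw [hρ_def, add_assoc, add_comm (ν.restrict _),
      Measure.restrict_add_restrict_compl F.measurableSet]
  have hρ : ρ ≤ μ + ν := add_le_add le_rfl Measure.restrict_le_self
  have hρb : ρ Set.univ ≤ b := by
    rw [hρ_def, Measure.add_apply, Measure.restrict_apply_univ, add_comm]
    exact (lt_tsub_iff_right.1 hF).le
  have hF_null : ν.restrict F (F : Set ℝ)ᶜ = 0 := by
    rw [Measure.restrict_apply F.measurableSet.compl, Set.compl_inter_self, measure_empty]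
  refine ⟨entropy ((μ + ν).map (quantize 0)) + 1 + F.card, by finiteness, fun n => ?_⟩
  have hq := measurable_quantize 0
  calc entropy ((μ + ν).map (quantize n))
      ≤ entropy (ρ.map (quantize n)) + entropy ((ν.restrict F).map (quantize n)) := by
        rw [hsplit, Measure.map_add _ _ (measurable_quantize n)]
        exact entropy_add_le _ _
    _ ≤ entropy (ρ.map (quantize 0)) + ρ Set.univ * n + F.card := by
        gcongr
        · exact entropy_map_quantize_le n ((hρ _).trans hmass)
        · exact entropy_map_le_of_encard_le (measurable_quantize n) hF_null
            (Set.encard_coe_eq_coe_finsetCard F).le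
    _ ≤ entropy ((μ + ν).map (quantize 0)) + 1 + b * n + F.card := by
        gcongr
        exact entropy_le_entropy_add_one (Measure.map_mono hρ hq) (by simpa [hq] using hmass)
    _ = _ := by ring

/-- Rényi's theorem on the information dimension of a mixed law, scaled to arbitrary mass at most
one. -/
theorem tendsto_entropy_map_quantize_div (hμ : μ ≪ volume) (hν : IsDiscrete ν)
    (hmass : (μ + ν) Set.univ ≤ 1) (hfin : entropy ((μ + ν).map (quantize 0)) ≠ ⊤) :
    Tendsto (fun n : ℕ => entropy ((μ + ν).map (quantize n)) / n) atTop (𝓝 (μ Set.univ)) :=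
  tendsto_div_natCast_of_forall_lt
    (fun _ hb => exists_mul_le_entropy_map_quantize_add hμ hmass hb)
    fun _ hb => exists_entropy_map_quantize_le_mul_add hν hmass hfin hb

lemma tendsto_entropy_map_quantize_cond_div [IsProbabilityMeasure (μ + ν)] (hμ : μ ≪ volume)
    (hν : IsDiscrete ν) (hfin : entropy ((μ + ν).map (quantize 0)) ≠ ⊤) {s : Set ℝ}
    (hs : (μ + ν) s ≠ 0) :
    Tendsto (fun n : ℕ => entropy (((μ + ν)[|s]).map (quantize n)) / n) atTop
      (𝓝 (μ s / (μ + ν) s)) := by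
  have hprob : IsProbabilityMeasure ((μ + ν)[|s]) := cond_isProbabilityMeasure hs
  have hc_top : ((μ + ν) s)⁻¹ ≠ ⊤ := ENNReal.inv_ne_top.2 hs
  have hcond_fin : entropy (((μ + ν)[|s]).map (quantize 0)) ≠ ⊤ := by
    refine ne_top_of_le_ne_top (b := ((μ + ν) s)⁻¹ * (entropy ((μ + ν).map (quantize 0)) + 1))
      (by finiteness) ?_
    rw [ProbabilityTheory.cond, Measure.map_smul]
    refine (entropy_smul_le (ENNReal.one_le_inv.2 prob_le_one) hc_top _).trans ?_
    gcongr
    refine entropy_le_entropy_add_one (Measure.map_mono Measure.restrict_le_self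
      (measurable_quantize 0)) ?_
    rw [Measure.map_apply (measurable_quantize 0) .univ, Set.preimage_univ, measure_univ]
  have hmass : (((μ + ν) s)⁻¹ • μ.restrict s) Set.univ = μ s / (μ + ν) s := by
    rw [Measure.smul_apply, Measure.restrict_apply_univ, smul_eq_mul, mul_comm, div_eq_mul_inv]
  rw [← hmass]
  simp only [ProbabilityTheory.cond, Measure.restrict_add, smul_add] at hprob hcond_fin ⊢
  exact tendsto_entropy_map_quantize_div
    ((Measure.absolutelyContinuous_restrict.trans hμ).smul_left _)
    (hν.of_absolutelyContinuous (Measure.absolutelyContinuous_restrict.smul_left _))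
    prob_le_one hcond_fin

end Renyi

section CondDistrib

variable {Ω β γ : Type*} [MeasurableSpace Ω] [MeasurableSpace β] [StandardBorelSpace β]
  [Nonempty β] [MeasurableSpace γ] {P : Measure Ω} [IsFiniteMeasure P] {X : Ω → β} {g : β → γ}

lemma condDistrib_comp_self_apply [MeasurableSingletonClass γ] (hX : Measurable X)
    (hg : Measurable g) {y : γ} (hy : P.map (g ∘ X) {y} ≠ 0) :
    condDistrib X (g ∘ X) P y = (P.map X)[|g ⁻¹' {y}] := by
  have hgy := hg (measurableSet_singleton y)
  ext s hs
  rw [condDistrib_apply_of_ne_zero hX y hy, cond_apply hgy, Measure.map_apply hX hgy,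
    Measure.map_apply (hg.comp hX) (measurableSet_singleton y), Set.preimage_comp,
    Measure.map_apply ((hg.comp hX).prodMk hX) ((measurableSet_singleton y).prod hs),
    Measure.map_apply hX (hgy.inter hs), Set.mk_preimage_prod, Set.preimage_comp,
    Set.preimage_inter]

lemma ae_condDistrib_comp_self [MeasurableEq γ] (hX : Measurable X) (hg : Measurable g)
    {s : Set β} (hs : MeasurableSet s) (hXs : ∀ᵐ ω ∂P, X ω ∈ s) :
    ∀ᵐ y ∂(P.map (g ∘ X)), ∀ᵐ x ∂(condDistrib X (g ∘ X) P y), x ∈ s ∧ g x = y := by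
  refine Measure.ae_ae_of_ae_compProd (p := fun z : γ × β => z.2 ∈ s ∧ g z.2 = z.1) ?_
  rw [compProd_map_condDistrib hX.aemeasurable, ae_map_iff ((hg.comp hX).prodMk hX).aemeasurable]
  · filter_upwards [hXs] with ω hω using ⟨hω, rfl⟩
  · exact (measurable_snd hs).inter
      (measurableSet_eq_fun (hg.comp measurable_snd) measurable_fst)

end CondDistrib

lemma measure_preimage_image_eq {α β : Type*} [MeasurableSpace α] {μ : Measure α}
    [NullSingletonClass μ] {g : α → β} {s A : Set α} (hs : μ sᶜ = 0) (hA : (g '' A).Countable)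
    (hfib : ∀ y, ((s \ A) ∩ g ⁻¹' {y}).Countable) : μ (g ⁻¹' (g '' A)) = μ A := by
  have hsub : g ⁻¹' (g '' A) ⊆ A ∪ (sᶜ ∪ ⋃ y ∈ g '' A, (s \ A) ∩ g ⁻¹' {y}) := fun x hx => by
    by_cases hxA : x ∈ A
    · exact Or.inl hxA
    by_cases hxs : x ∈ s
    · exact Or.inr (Or.inr (Set.mem_biUnion hx ⟨⟨hxs, hxA⟩, rfl⟩))
    · exact Or.inr (Or.inl hxs)
  have hnull : μ (sᶜ ∪ ⋃ y ∈ g '' A, (s \ A) ∩ g ⁻¹' {y}) = 0 :=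
    measure_union_null hs ((hA.biUnion fun y _ => hfib y).measure_zero μ)
  refine le_antisymm ?_ (measure_mono (Set.subset_preimage_image g A))
  exact (measure_mono hsub).trans ((measure_union_le _ _).trans_eq (by rw [hnull, add_zero]))

section CondEntropy

variable {Ω : Type*} [MeasurableSpace Ω] {P : Measure Ω}

lemma condEntropy_congr_right [IsFiniteMeasure P] {Z Y Y' : Ω → ℝ} (h : Y =ᵐ[P] Y') :
    condEntropy P Z Y = condEntropy P Z Y' := by
  rw [condEntropy, condEntropy, condDistrib_congr_right h, Measure.map_congr h]

lemma condEntropy_comp_left [IsFiniteMeasure P] {X Y : Ω → ℝ} {f : ℝ → ℝ} (hX : Measurable X)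
    (hf : Measurable f) :
    condEntropy P (f ∘ X) Y = ∫⁻ y, entropy ((condDistrib X Y P y).map f) ∂(P.map Y) := by
  refine lintegral_congr_ae ?_
  filter_upwards [condDistrib_comp Y hX.aemeasurable hf] with y hy
  rw [hy, Kernel.map_apply _ hf]

lemma hasRelInfoLoss_of_tendsto_div [IsFiniteMeasure P] {X Y : Ω → ℝ} {m c : ℝ≥0∞} (hm : m ≠ 0)
    (hm_top : m ≠ ⊤)
    (hH : Tendsto (fun n : ℕ => entropy (P.map (quantize n ∘ X)) / n) atTop (𝓝 m))
    (hcond : Tendsto (fun n : ℕ => condEntropy P (quantize n ∘ X) Y / n) atTop (𝓝 c)) :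
    HasRelInfoLoss P X Y (c / m) := by
  constructor
  · filter_upwards [hH.eventually (lt_mem_nhds hm.bot_lt),
      hH.eventually (gt_mem_nhds hm_top.lt_top)] with n hpos hlt
    refine ⟨(ENNReal.div_pos_iff.1 hpos).1.bot_lt, lt_top_iff_ne_top.2 fun htop => hlt.ne ?_⟩
    exact htop ▸ ENNReal.top_div_of_ne_top (ENNReal.natCast_ne_top n)
  · refine (ENNReal.Tendsto.div hcond (Or.inr hm) hH (Or.inl hm_top)).congr' ?_
    filter_upwards [eventually_gt_atTop 0] with n hn
    simp only [div_eq_mul_inv _ (n : ℝ≥0∞)]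
    exact ENNReal.mul_div_mul_right _ _ (ENNReal.inv_ne_zero.2 (ENNReal.natCast_ne_top n))
      (ENNReal.inv_ne_top.2 (by exact_mod_cast hn.ne'))

lemma HasRelInfoLoss.congr_right [IsFiniteMeasure P] {X Y Y' : Ω → ℝ} {l : ℝ≥0∞}
    (h : HasRelInfoLoss P X Y l) (hY : Y =ᵐ[P] Y') : HasRelInfoLoss P X Y' l := by
  simpa only [HasRelInfoLoss, condEntropy_congr_right hY] using h

variable [IsProbabilityMeasure P] {X : Ω → ℝ} {μ ν : Measure ℝ} {g : ℝ → ℝ}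

lemma tendsto_entropy_condDistrib_mul_div (hX : Measurable X) (hdecomp : P.map X = μ + ν)
    (hμ : μ ≪ volume) (hν : IsDiscrete ν) (hfin : entropy ((P.map X).map (quantize 0)) ≠ ⊤)
    (hg : Measurable g) (y : ℝ) :
    Tendsto (fun n : ℕ => entropy ((condDistrib X (g ∘ X) P y).map (quantize n)) *
      P.map (g ∘ X) {y} / n) atTop (𝓝 (μ (g ⁻¹' {y}))) := by
  have hPX : IsProbabilityMeasure (P.map X) := Measure.isProbabilityMeasure_map hX.aemeasurable
  have hPY : P.map (g ∘ X) {y} = (μ + ν) (g ⁻¹' {y}) := by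
    rw [← hdecomp, ← Measure.map_map hg hX, Measure.map_apply hg (measurableSet_singleton y)]
  by_cases hy : P.map (g ∘ X) {y} = 0
  · have hμy : μ (g ⁻¹' {y}) = 0 := by
      rw [hPY, Measure.add_apply, add_eq_zero] at hy
      exact hy.1
    simp [hy, hμy]
  rw [condDistrib_comp_self_apply hX hg hy]
  rw [hPY] at hy ⊢
  rw [hdecomp] at hPX hfin ⊢
  have hlim := ENNReal.Tendsto.mul_const (tendsto_entropy_map_quantize_cond_div hμ hν hfin hy)
    (Or.inr (measure_ne_top (μ + ν) (g ⁻¹' {y})))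
  rw [ENNReal.div_mul_cancel hy (measure_ne_top _ _)] at hlim
  refine hlim.congr fun n => ?_
  simp only [div_eq_mul_inv, mul_right_comm]

variable {𝒳 A : Set ℝ} {N : ℕ}

lemma setLIntegral_entropy_condDistrib_le {α : Type*} [MeasurableSpace α]
    [MeasurableSingletonClass α] {f : ℝ → α} (hf : Measurable f) (hX : Measurable X)
    (h𝒳 : MeasurableSet 𝒳) (hX𝒳 : ∀ᵐ ω ∂P, X ω ∈ 𝒳) (hg : Measurable g) {C : Set ℝ}
    (hC : MeasurableSet C) (hN : ∀ y ∈ C, (𝒳 ∩ g ⁻¹' {y}).encard ≤ N) :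
    ∫⁻ y in C, entropy ((condDistrib X (g ∘ X) P y).map f) ∂(P.map (g ∘ X)) ≤ N := by
  have : IsProbabilityMeasure (P.map (g ∘ X)) :=
    Measure.isProbabilityMeasure_map (hg.comp hX).aemeasurable
  calc ∫⁻ y in C, entropy ((condDistrib X (g ∘ X) P y).map f) ∂(P.map (g ∘ X))
      ≤ ∫⁻ _ in C, N ∂(P.map (g ∘ X)) := by
        refine lintegral_mono_ae ?_
        filter_upwards [ae_restrict_of_ae (ae_condDistrib_comp_self hX hg h𝒳 hX𝒳),
          ae_restrict_mem hC] with y hy hyC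
        exact entropy_map_le_of_encard_le hf (mem_ae_iff.1 hy) (hN y hyC)
    _ ≤ N := by
        rw [setLIntegral_const]
        exact mul_le_of_le_one_right' prob_le_one

lemma tendsto_condEntropy_quantize_div (hX : Measurable X) (hdecomp : P.map X = μ + ν)
    (hμ : μ ≪ volume) (hν : IsDiscrete ν) (hfin : entropy ((P.map X).map (quantize 0)) ≠ ⊤)
    (h𝒳 : MeasurableSet 𝒳) (hX𝒳 : ∀ᵐ ω ∂P, X ω ∈ 𝒳) (hμ𝒳 : μ 𝒳ᶜ = 0) (hg : Measurable g)
    (hA : (g '' A).Finite) (hN : ∀ y, ((𝒳 \ A) ∩ g ⁻¹' {y}).encard ≤ N) :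
    Tendsto (fun n : ℕ => condEntropy P (quantize n ∘ X) (g ∘ X) / n) atTop (𝓝 (μ A)) := by
  have : NullSingletonClass μ := ⟨fun x => hμ (measure_singleton x)⟩
  obtain ⟨C, hC⟩ := hA.exists_finset_coe
  have hatoms := tendsto_finsetSum C fun y _ =>
    tendsto_entropy_condDistrib_mul_div hX hdecomp hμ hν hfin hg y
  rw [sum_measure_preimage_singleton C fun y _ => hg (measurableSet_singleton y), hC,
    measure_preimage_image_eq hμ𝒳 hA.countable fun y =>
      (Set.finite_of_encard_le_coe (hN y)).countable] at hatoms
  have hfib : ∀ y ∈ (C : Set ℝ)ᶜ, (𝒳 ∩ g ⁻¹' {y}).encard ≤ N := fun y hy =>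
    (hN y).trans' <| Set.encard_le_encard fun x ⟨hx𝒳, hxy⟩ =>
      ⟨⟨hx𝒳, fun hxA => hy (hC.ge ⟨x, hxA, hxy⟩)⟩, hxy⟩
  have hrest : Tendsto (fun n : ℕ => (∫⁻ y in (C : Set ℝ)ᶜ,
      entropy ((condDistrib X (g ∘ X) P y).map (quantize n)) ∂(P.map (g ∘ X))) / n)
      atTop (𝓝 0) := by
    have hN_div : Tendsto (fun n : ℕ => (N : ℝ≥0∞) / n) atTop (𝓝 0) := by
      simpa only [ENNReal.div_top] using ENNReal.Tendsto.const_div ENNReal.tendsto_nat_nhds_top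
        (Or.inr (ENNReal.natCast_ne_top N))
    exact tendsto_of_tendsto_of_tendsto_of_le_of_le tendsto_const_nhds hN_div (fun _ => zero_le)
      fun n => ENNReal.div_le_div_right (setLIntegral_entropy_condDistrib_le
        (measurable_quantize n) hX h𝒳 hX𝒳 hg C.measurableSet.compl hfib) _
  rw [← add_zero (μ A)]
  refine (hatoms.add hrest).congr fun n => ?_
  rw [condEntropy_comp_left hX (measurable_quantize n),
    ← lintegral_add_compl (μ := P.map (g ∘ X)) _ C.measurableSet, lintegral_finset, ENNReal.add_div]
  simp only [div_eq_mul_inv, Finset.sum_mul]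

lemma hasRelInfoLoss_comp (hX : Measurable X) (hdecomp : P.map X = μ + ν) (hμ : μ ≪ volume)
    (hν : IsDiscrete ν) (hfin : entropy ((P.map X).map (quantize 0)) ≠ ⊤) (h𝒳 : MeasurableSet 𝒳)
    (hX𝒳 : ∀ᵐ ω ∂P, X ω ∈ 𝒳) (hpos : 0 < μ 𝒳) (hg : Measurable g) (hA : (g '' A).Finite)
    (hN : ∀ y, ((𝒳 \ A) ∩ g ⁻¹' {y}).encard ≤ N) :
    HasRelInfoLoss P X (g ∘ X) (μ A / μ 𝒳) := by
  have hPX : IsProbabilityMeasure (P.map X) := Measure.isProbabilityMeasure_map hX.aemeasurable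
  have hμ_le : μ ≤ P.map X := hdecomp ▸ Measure.le_add_right le_rfl
  have hμ_compl : μ 𝒳ᶜ = 0 :=
    hμ_le.absolutelyContinuous (mem_ae_iff.1 ((ae_map_iff hX.aemeasurable h𝒳).2 hX𝒳))
  have hμ_univ : μ Set.univ = μ 𝒳 := by rw [← measure_inter_conull hμ_compl, Set.univ_inter]
  have hμ_top : μ 𝒳 ≠ ⊤ := ne_top_of_le_ne_top (measure_ne_top (P.map X) 𝒳) (hμ_le 𝒳)
  have hH : Tendsto (fun n : ℕ => entropy (P.map (quantize n ∘ X)) / n) atTop (𝓝 (μ 𝒳)) := by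
    simp only [← Measure.map_map (measurable_quantize _) hX, ← hμ_univ]
    rw [hdecomp] at hPX hfin ⊢
    exact tendsto_entropy_map_quantize_div hμ hν prob_le_one hfin
  exact hasRelInfoLoss_of_tendsto_div hpos.ne' hμ_top hH
    (tendsto_condEntropy_quantize_div hX hdecomp hμ hν hfin h𝒳 hX𝒳 hμ_compl hg hA hN)

end CondEntropy

section Pieces

variable {ι : Type*} [Finite ι] {g : ℝ → ℝ}

lemma finite_image_biUnion_isConstOn (piece : ι → Set ℝ) (g : ℝ → ℝ) :
    (g '' ⋃ i ∈ {i | IsConstOn g (piece i)}, piece i).Finite := by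
  rw [Set.image_iUnion₂]
  refine (Set.toFinite _).biUnion fun i ⟨c, hc⟩ => (Set.finite_singleton c).subset ?_
  rintro _ ⟨x, hx, rfl⟩
  exact hc x hx

lemma encard_iUnion_diff_inter_fiber_le {piece : ι → Set ℝ}
    (hg : ∀ i, Set.InjOn g (piece i) ∨ IsConstOn g (piece i)) (y : ℝ) :
    (((⋃ i, piece i) \ ⋃ i ∈ {i | IsConstOn g (piece i)}, piece i) ∩ g ⁻¹' {y}).encard
      ≤ Nat.card ι := by
  have := Fintype.ofFinite ι
  set A := ⋃ i ∈ {i | IsConstOn g (piece i)}, piece i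
  have hpiece (i : ι) : ((piece i \ A) ∩ g ⁻¹' {y}).encard ≤ 1 := by
    rw [Set.encard_le_one_iff_subsingleton]
    rintro x ⟨⟨hxi, hxA⟩, hxy⟩ x' ⟨⟨hxi', -⟩, hxy'⟩
    have hinj := (hg i).resolve_right fun hconst => hxA (Set.mem_biUnion hconst hxi)
    exact hinj hxi hxi' (hxy.trans hxy'.symm)
  rw [Set.iUnion_sdiff, Set.iUnion_inter]
  calc (⋃ i, (piece i \ A) ∩ g ⁻¹' {y}).encard
      ≤ ∑ i, ((piece i \ A) ∩ g ⁻¹' {y}).encard := Set.encard_iUnion_le_of_fintype _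
    _ ≤ ∑ _ : ι, 1 := Finset.sum_le_sum fun i _ => hpiece i
    _ = Nat.card ι := by simp [Nat.card_eq_fintype_card]

end Pieces

end InfoLoss

theorem proposition13_general {Ω : Type*} [MeasurableSpace Ω] (P : Measure Ω)
    [IsProbabilityMeasure P] (X : Ω → ℝ) (hX : Measurable X)
    (hfin : InfoLoss.entropy ((P.map X).map (InfoLoss.quantize 0)) ≠ ⊤)
    (Pac Pd : Measure ℝ) (hdecomp : P.map X = Pac + Pd)
    (hac : Pac ≪ volume) (hd : InfoLoss.IsDiscrete Pd)
    (𝒳 : Set ℝ) (h𝒳 : MeasurableSet 𝒳) (hX𝒳 : ∀ᵐ ω ∂P, X ω ∈ 𝒳) (hpos : 0 < Pac 𝒳)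
    (g : ℝ → ℝ) (hgmeas : Measurable (fun x : 𝒳 => g x))
    (A : Set ℝ) (hA𝒳 : A ⊆ 𝒳) (hA : (g '' A).Finite)
    (N : ℕ) (hN : ∀ y, ((𝒳 \ A) ∩ g ⁻¹' {y}).encard ≤ N) :
    InfoLoss.HasRelInfoLoss P X (fun ω => g (X ω)) (Pac A / Pac 𝒳) := by
  obtain ⟨G, hG, hG_comp⟩ :=
    (MeasurableEmbedding.subtype_coe h𝒳).exists_measurable_extend hgmeas fun _ => ⟨0⟩
  have hGg : Set.EqOn G g 𝒳 := fun x hx => congrFun hG_comp ⟨x, hx⟩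
  have hGX : G ∘ X =ᵐ[P] fun ω => g (X ω) := by filter_upwards [hX𝒳] with ω hω using hGg hω
  have hGA : (G '' A).Finite := (hGg.mono hA𝒳).image_eq ▸ hA
  have hGN (y : ℝ) : ((𝒳 \ A) ∩ G ⁻¹' {y}).encard ≤ N :=
    (hN y).trans' (Set.encard_le_encard fun x ⟨hx, hxy⟩ => ⟨hx, (hGg hx.1).symm.trans hxy⟩)
  exact (InfoLoss.hasRelInfoLoss_comp hX hdecomp hac hd hfin h𝒳 hX𝒳 hpos hG hGA
    hGN).congr_right hGX

theorem proposition13 {Ω : Type*} [MeasurableSpace Ω] (P : Measure Ω) [IsProbabilityMeasure P]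
    (X : Ω → ℝ) (hX : Measurable X)
    (Pac Pd : Measure ℝ) (hdecomp : P.map X = Pac + Pd)
    (hac : Pac ≪ volume) (hd : InfoLoss.IsDiscrete Pd)
    {ι : Type*} [Finite ι] (piece : ι → Set ℝ) (𝒳 : Set ℝ)
    (hdisj : Pairwise (fun i j => Disjoint (piece i) (piece j)))
    (hcover : ⋃ i, piece i = 𝒳)
    (hcompact : ∀ i, IsCompact (piece i))
    (hX𝒳 : ∀ᵐ ω ∂P, X ω ∈ 𝒳)
    (hpos : 0 < Pac 𝒳)
    (g : ℝ → ℝ) (hgmeas : Measurable (fun x : 𝒳 => g x))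
    (hgbdd : Bornology.IsBounded (g '' 𝒳))
    (hg : ∀ i, Set.InjOn g (piece i) ∨ InfoLoss.IsConstOn g (piece i)) :
    InfoLoss.HasRelInfoLoss P X (fun ω => g (X ω))
      (Pac (⋃ i ∈ {i | InfoLoss.IsConstOn g (piece i)}, piece i) / Pac 𝒳) := by
  have h𝒳 : IsCompact 𝒳 := hcover ▸ isCompact_iUnion hcompact
  exact proposition13_general P X hX (InfoLoss.entropy_map_quantize_zero_ne_top h𝒳.isBounded
      ((ae_map_iff hX.aemeasurable h𝒳.measurableSet).2 hX𝒳))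
    Pac Pd hdecomp hac hd 𝒳 h𝒳.measurableSet hX𝒳 hpos g hgmeas
    _ (hcover ▸ Set.iUnion₂_subset fun i _ => Set.subset_iUnion piece i)
    (InfoLoss.finite_image_biUnion_isConstOn piece g) _
    (hcover ▸ InfoLoss.encard_iUnion_diff_inter_fiber_le hg)
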